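/- All rings are commutative with identity. Let $R$ be a ring. A finitely generated ideal $J$ of $R$ is called a GV-ideal if $\operatorname{Hom}_R(R/J,R)=0$ and $\operatorname{Ext}^1_R(R/J,R)=0$; the set of all GV-ideals of $R$ is denoted by $\mathrm{GV}(R)$. For an $R$-module $M$ put $$\operatorname{tor}_{\mathrm{GV}}(M)=\{x\in M : Jx=0 \text{ for some } J\in \mathrm{GV}(R)\}.$$ The module $M$ is called GV-torsion if $\operatorname{tor}_{\mathrm{GV}}(M)=M$, and GV-torsion-free if $\operatorname{tor}_{\mathrm{GV}}(M)=0$. A $w$-module is a GV-torsion-free $R$-module $M$ such that $\operatorname{Ext}^1_R(R/J,M)=0$ for every $J\in \mathrm{GV}(R)$. A strong $w$-module is a $w$-module $M$ such that $\operatorname{Ext}^i_R(T,M)=0$ for every GV-torsion $R$-module $T$ and every integer $i\ge 2$. The ring $R$ is called a DW-ring if $\mathrm{GV}(R)=\{R\}$. **Proposition.** Let $R$ be a ring. Then $R$, regarded as a module over itself, is a strong $w$-module if and only if $R$ is a DW-ring. -/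

import Mathlib

open CategoryTheory

universe u

section GV

variable (R : Type u) [CommRing R]

/-- A `GV`-ideal: a finitely generated ideal `J` with `Hom_R(R/J, R) = 0` and
`Ext_R^1(R/J, R) = 0`. -/
def IsGVIdeal (J : Ideal R) : Prop :=
  J.FG ∧ Subsingleton ((R ⧸ J) →ₗ[R] R) ∧
    Subsingleton (Abelian.Ext (ModuleCat.of R (R ⧸ J)) (ModuleCat.of R R) 1)

/-- `GV(R)`, the set of all `GV`-ideals of `R`. -/
def GV : Set (Ideal R) := {J | IsGVIdeal R J}

variable (M : Type u) [AddCommGroup M] [Module R M]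

/-- `tor_GV(M)`: the elements of `M` annihilated by some `GV`-ideal of `R`
(as a subset of `M`). -/
def torGV : Set M := {x | ∃ J ∈ GV R, ∀ a ∈ J, a • x = 0}

/-- `M` is `GV`-torsion: `tor_GV(M) = M`. -/
def IsGVTorsion : Prop := torGV R M = Set.univ

/-- `M` is `GV`-torsion-free: `tor_GV(M) = 0`. -/
def IsGVTorsionFree : Prop := torGV R M = {0}

/-- A `w`-module: a `GV`-torsion-free module `M` with `Ext_R^1(R/J, M) = 0` for all
`J ∈ GV(R)`. -/
def IsWModule : Prop :=
  IsGVTorsionFree R M ∧ ∀ J ∈ GV R,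
    Subsingleton (Abelian.Ext (ModuleCat.of R (R ⧸ J)) (ModuleCat.of R M) 1)

/-- A strong `w`-module: a `w`-module `M` with `Ext_R^i(T, M) = 0` for all `GV`-torsion
modules `T` and all `i ≥ 2`. -/
def IsStrongWModule : Prop :=
  IsWModule R M ∧ ∀ (T : Type u) [AddCommGroup T] [Module R T], IsGVTorsion R T →
    ∀ i : ℕ, 2 ≤ i → Subsingleton (Abelian.Ext (ModuleCat.of R T) (ModuleCat.of R M) i)

/-- A `DW`-ring: `GV(R) = {R}`. -/
def IsDWRing : Prop := GV R = {⊤}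

end GV

open CategoryTheory Abelian

universe v

/-! ### Consequences of the contravariant long exact sequence -/

section Ext

variable {R : Type u} [CommRing R] {A B C Y : Type u} [AddCommGroup A] [Module R A]
  [AddCommGroup B] [Module R B] [AddCommGroup C] [Module R C] [AddCommGroup Y] [Module R Y]

/-! Let `J` be a GV-ideal generated by a finite set `S`, and let `K` be the Koszul complex on `S`.
Each generator is null-homotopic on `K`, so `J` kills its homology, which is therefore GV-torsion.
If `R` is strong, dimension shifting kills the positive Ext groups from the boundaries of `K` to `R`
(`subsingleton_ext_range`), so `Hom(K, R)` is exact (`eq_zero_of_comp_d_eq_zero`,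
`exists_comp_d_eq`). But its top cocycle takes the value 1, whereas coboundaries take values in `J`;
hence `1 ∈ J`. Conversely, over a DW-ring only the zero module is GV-torsion. -/

/-- The short exact sequence of `ModuleCat R` given by linear maps. -/
lemma moduleCat_shortExact_of_linearMap (f : A →ₗ[R] B) (g : B →ₗ[R] C)
    (hf : Function.Injective f) (hg : Function.Surjective g) (hfg : Function.Exact f g) :
    (ShortComplex.mk (ModuleCat.ofHom f) (ModuleCat.ofHom g)
      (by ext x; exact hfg.apply_apply_eq_zero x)).ShortExact :=
  ModuleCat.shortComplex_shortExact _ hfg hf hg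

/-- The long exact sequence places `Ext^n(A, Y)` between `Ext^n(B, Y)` and `Ext^(n+1)(C, Y)`. -/
lemma subsingleton_ext_of_shortExact (f : A →ₗ[R] B) (g : B →ₗ[R] C)
    (hf : Function.Injective f) (hg : Function.Surjective g) (hfg : Function.Exact f g) (n : ℕ)
    (hB : Subsingleton (Ext (ModuleCat.of R B) (ModuleCat.of R Y) n))
    (hC : Subsingleton (Ext (ModuleCat.of R C) (ModuleCat.of R Y) (n + 1))) :
    Subsingleton (Ext (ModuleCat.of R A) (ModuleCat.of R Y) n) := by
  have hS := moduleCat_shortExact_of_linearMap f g hf hg hfg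
  refine subsingleton_of_forall_eq 0 fun x => ?_
  obtain ⟨y, rfl⟩ := Ext.contravariant_sequence_exact₁ hS _ x (add_comm 1 n)
    (hC.elim _ _)
  rw [hB.elim y 0, Ext.comp_zero]

/-- A linear map extends along an injection whose cokernel has vanishing `Ext¹`. -/
lemma exists_extend_of_subsingleton_ext (f : A →ₗ[R] B) (g : B →ₗ[R] C)
    (hf : Function.Injective f) (hg : Function.Surjective g) (hfg : Function.Exact f g)
    (hC : Subsingleton (Ext (ModuleCat.of R C) (ModuleCat.of R Y) 1)) (φ : A →ₗ[R] Y) :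
    ∃ ψ : B →ₗ[R] Y, ψ ∘ₗ f = φ := by
  have hS := moduleCat_shortExact_of_linearMap f g hf hg hfg
  obtain ⟨y, hy⟩ := Ext.contravariant_sequence_exact₁ hS (ModuleCat.of R Y)
    (Ext.mk₀ (ModuleCat.ofHom φ)) (add_comm 1 0) (hC.elim _ _)
  obtain ⟨ψ, rfl⟩ := Ext.mk₀_bijective _ _ |>.2 y
  rw [Ext.mk₀_comp_mk₀] at hy
  have h := (Ext.mk₀_bijective _ _).1 hy
  exact ⟨ψ.hom, congrArg ModuleCat.Hom.hom h⟩

end Ext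

/-! ### Functionals and GV-ideals -/

section GVIdeal

variable {R : Type u} [CommRing R] {J : Ideal R}

lemma IsGVIdeal.eq_zero_of_forall_mul_eq_zero (hJ : IsGVIdeal R J) {r : R}
    (hr : ∀ a ∈ J, a * r = 0) : r = 0 := by
  have h := hJ.2.1.elim (J.liftQ (LinearMap.toSpanSingleton R R r) fun a ha => hr a ha) 0
  have h1 : 1 * r = 0 := LinearMap.congr_fun h (J.mkQ 1)
  rwa [one_mul] at h1

/-- Since `Ext¹(R/J, R) = 0`, the functional extends to `R`; `c` is the value of the extension at 1.
-/
lemma IsGVIdeal.exists_forall_apply_eq_mul (hJ : IsGVIdeal R J) (f : J →ₗ[R] R) :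
    ∃ c : R, ∀ a : J, f a = a * c := by
  obtain ⟨ψ, rfl⟩ := exists_extend_of_subsingleton_ext J.subtype J.mkQ J.subtype_injective
    J.mkQ_surjective (LinearMap.exact_subtype_mkQ J) hJ.2.2 f
  refine ⟨ψ 1, fun a => ?_⟩
  simpa using ψ.map_smul (a : R) 1

/-- A functional killing the kernel of `δ` factors through `δ` if the cokernel of `δ` is killed
by a `GV`-ideal. -/
lemma IsGVIdeal.exists_comp_eq (hJ : IsGVIdeal R J) {A Z : Type v} [AddCommGroup A] [Module R A]
    [AddCommGroup Z] [Module R Z] (δ : A →ₗ[R] Z) (hδ : ∀ a ∈ J, ∀ z, a • z ∈ LinearMap.range δ)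
    (φ : A →ₗ[R] R) (hφ : LinearMap.ker δ ≤ LinearMap.ker φ) : ∃ g : Z →ₗ[R] R, g ∘ₗ δ = φ := by
  obtain ⟨φ', hφ'⟩ : ∃ φ' : LinearMap.range δ →ₗ[R] R, ∀ x, φ' ⟨δ x, x, rfl⟩ = φ x := by
    refine ⟨(LinearMap.ker δ).liftQ φ hφ ∘ₗ δ.quotKerEquivRange.symm.toLinearMap, fun x => ?_⟩
    have : δ.quotKerEquivRange.symm ⟨δ x, x, rfl⟩ = (LinearMap.ker δ).mkQ x := by
      rw [LinearEquiv.symm_apply_eq]; rfl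
    simp [this]
  have key : ∀ z : Z, ∃ c : R, ∀ a (ha : a ∈ J), φ' ⟨a • z, hδ a ha z⟩ = a * c := by
    intro z
    obtain ⟨c, hc⟩ := hJ.exists_forall_apply_eq_mul
      (φ' ∘ₗ LinearMap.codRestrict (LinearMap.range δ)
        (LinearMap.toSpanSingleton R Z z ∘ₗ J.subtype) fun a => hδ a a.2 z)
    exact ⟨c, fun a ha => hc ⟨a, ha⟩⟩
  choose g hg using key
  -- The scalar `g z` is unique because `R` has no `J`-torsion, so each identity may be checked
  -- after multiplication by elements of `J`.
  refine ⟨⟨⟨g, fun x y => ?_⟩, fun r x => ?_⟩, ?_⟩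
  · rw [← sub_eq_zero]
    refine hJ.eq_zero_of_forall_mul_eq_zero fun a ha => ?_
    rw [mul_sub, mul_add, ← hg _ a ha, ← hg _ a ha, ← hg _ a ha, ← map_add, ← map_sub]
    convert φ'.map_zero
    simp
  · rw [← sub_eq_zero]
    refine hJ.eq_zero_of_forall_mul_eq_zero fun a ha => ?_
    rw [RingHom.id_apply, smul_eq_mul, mul_sub, mul_left_comm, ← hg _ a ha, ← hg _ a ha,
      ← smul_eq_mul, ← map_smul, ← map_sub]
    convert φ'.map_zero
    simp [smul_comm a r x]
  · ext x
    change g (δ x) = φ x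
    rw [← sub_eq_zero]
    refine hJ.eq_zero_of_forall_mul_eq_zero fun a ha => ?_
    rw [mul_sub, ← hg _ a ha, ← smul_eq_mul a (φ x), ← φ.map_smul, ← hφ', ← map_sub]
    convert φ'.map_zero
    simp

lemma IsGVIdeal.isGVTorsion (hJ : IsGVIdeal R J) {T : Type u} [AddCommGroup T] [Module R T]
    (hT : ∀ a ∈ J, ∀ x : T, a • x = 0) : IsGVTorsion R T :=
  Set.eq_univ_of_forall fun x => ⟨J, hJ, fun a ha => hT a ha x⟩

end GVIdeal

/-! ### Koszul complexes and exactness of their duals -/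

section Koszul

/-- A Koszul-type complex on a set `S` of ring elements: a complex of projective modules on which
every element of `S` is null-homotopic, whose differentials have all coefficients in the ideal
spanned by `S`, with a unimodular top class. -/
structure KoszulLikeComplex (R : Type u) [CommRing R] (S : Set R) where
  /-- The terms of the complex. -/
  X : ℕ → ModuleCat.{u} R
  /-- The differentials of the complex. -/
  d : ∀ i, X (i + 1) →ₗ[R] X i
  projective : ∀ i, Module.Projective R (X i)
  d_d : ∀ i x, d i (d (i + 1) x) = 0
  exists_homotopy : ∀ a ∈ S, ∃ h : ∀ i, X i →ₗ[R] X (i + 1),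
    (∀ x, d 0 (h 0 x) = a • x) ∧ ∀ i x, d (i + 1) (h (i + 1) x) + h i (d i x) = a • x
  apply_d_mem : ∀ i (ψ : X i →ₗ[R] R) x, ψ (d i x) ∈ Ideal.span S
  exists_top : ∃ n, ∃ φ : X n →ₗ[R] R, φ ∘ₗ d n = 0 ∧ ∃ e, φ e = 1

namespace KoszulLikeComplex

variable {R : Type u} [CommRing R] {S : Set R}

/-- The terms of `KoszulLikeComplex.base`. -/
def baseX (R : Type u) [CommRing R] : ℕ → ModuleCat.{u} R
  | 0 => ModuleCat.of R R
  | _ + 1 => ModuleCat.of R PUnit.{u + 1}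

/-- The ring concentrated in degree zero. -/
def base (R : Type u) [CommRing R] : KoszulLikeComplex R ∅ where
  X := baseX R
  d _ := 0
  projective
    | 0 => inferInstanceAs (Module.Projective R R)
    | _ + 1 => inferInstanceAs (Module.Projective R PUnit.{u + 1})
  d_d _ _ := rfl
  exists_homotopy _ ha := ha.elim
  apply_d_mem _ ψ _ := by simp
  exists_top := ⟨0, (LinearMap.id : R →ₗ[R] R), LinearMap.comp_zero _, (1 : R), rfl⟩

/-- The terms of `KoszulLikeComplex.cone`. -/
def coneX (K : KoszulLikeComplex R S) : ℕ → ModuleCat.{u} R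
  | 0 => K.X 0
  | i + 1 => ModuleCat.of R (K.X (i + 1) × K.X i)

/-- The differentials of `KoszulLikeComplex.cone`. -/
def coneD (K : KoszulLikeComplex R S) (a : R) : ∀ i, K.coneX (i + 1) →ₗ[R] K.coneX i
  | 0 => LinearMap.coprod (K.d 0) (a • LinearMap.id)
  | i + 1 => LinearMap.prod (LinearMap.coprod (K.d (i + 1)) (a • LinearMap.id))
      (-(K.d i ∘ₗ LinearMap.snd R _ _))

/-- The homotopy on the cone induced by a homotopy. -/
def coneHomotopy (K : KoszulLikeComplex R S) (h : ∀ i, K.X i →ₗ[R] K.X (i + 1)) :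
    ∀ i, K.coneX i →ₗ[R] K.coneX (i + 1)
  | 0 => LinearMap.prod (h 0) 0
  | i + 1 => LinearMap.prodMap (h (i + 1)) (-h i)

/-- The null-homotopy on the cone of a scalar of multiplication by that scalar. -/
def coneNullHomotopy (K : KoszulLikeComplex R S) : ∀ i, K.coneX i →ₗ[R] K.coneX (i + 1)
  | 0 => LinearMap.inr R _ _
  | _ + 1 => LinearMap.inr R _ _ ∘ₗ LinearMap.fst R _ _

/-- The mapping cone of multiplication by `a`. -/
def cone (K : KoszulLikeComplex R S) (a : R) : KoszulLikeComplex R (insert a S) where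
  X := K.coneX
  d := K.coneD a
  projective
    | 0 => K.projective 0
    | i + 1 =>
      have := K.projective (i + 1)
      have := K.projective i
      inferInstanceAs (Module.Projective R (K.X (i + 1) × K.X i))
  d_d
    | 0, (x, y) => by
      have key : K.d 0 (K.d 1 x + a • y) + a • -K.d 0 y = 0 := by simp [K.d_d]
      exact key
    | i + 1, (x, y) => by
      have key : (K.d (i + 1) (K.d (i + 2) x + a • y) + a • -K.d (i + 1) y,
          -K.d i (-K.d (i + 1) y)) = 0 := by simp [K.d_d]
      exact key
  exists_homotopy b hb := by
    rcases hb with rfl | hb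
    · refine ⟨K.coneNullHomotopy, fun (x : K.X 0) => ?_, fun i (x : K.X (i + 1) × K.X i) => ?_⟩
      · have key : K.d 0 0 + b • x = b • x := by simp
        exact key
      · obtain ⟨x, y⟩ := x
        have key : (K.d (i + 1) 0 + b • x, -K.d i x) + (0, K.d i x + b • y) = (b • x, b • y) := by
          simp
        cases i <;> exact key
    · obtain ⟨h, h0, h1⟩ := K.exists_homotopy b hb
      refine ⟨K.coneHomotopy h, fun (x : K.X 0) => ?_, fun i (x : K.X (i + 1) × K.X i) => ?_⟩
      · have key : K.d 0 (h 0 x) + a • 0 = b • x := by simp [h0]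
        exact key
      · obtain ⟨x, y⟩ := x
        cases i with
        | zero =>
          have key : (K.d 1 (h 1 x) + a • -h 0 y, -K.d 0 (-h 0 y)) +
              (h 0 (K.d 0 x + a • y), 0) = (b • x, b • y) := by
            simp only [Prod.mk_add_mk, ← h1, ← h0, map_add, map_neg, map_smul, smul_neg]
            congr 1 <;> abel
          exact key
        | succ i =>
          have key : (K.d (i + 2) (h (i + 2) x) + a • -h (i + 1) y, -K.d (i + 1) (-h (i + 1) y)) +
              (h (i + 1) (K.d (i + 1) x + a • y), -h i (-K.d i y)) = (b • x, b • y) := by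
            simp only [Prod.mk_add_mk, ← h1, map_add, map_neg, map_smul, smul_neg]
            congr 1 <;> abel
          exact key
  apply_d_mem i ψ x := by
    have hle : Ideal.span S ≤ Ideal.span (insert a S) := Ideal.span_mono (Set.subset_insert a S)
    have ha : a ∈ Ideal.span (insert a S) := Ideal.subset_span (Set.mem_insert a S)
    cases i with
    | zero =>
      obtain ⟨x, y⟩ : K.X 1 × K.X 0 := x
      have key (ψ : K.X 0 →ₗ[R] R) : ψ (K.d 0 x + a • y) ∈ Ideal.span (insert a S) := by
        rw [map_add, map_smul]
        exact add_mem (hle (K.apply_d_mem 0 ψ x)) (Ideal.mul_mem_right _ _ ha)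
      exact key ψ
    | succ i =>
      obtain ⟨x, y⟩ : K.X (i + 2) × K.X (i + 1) := x
      have key (ψ : K.X (i + 1) × K.X i →ₗ[R] R) :
          ψ (K.d (i + 1) x + a • y, -K.d i y) ∈ Ideal.span (insert a S) := by
        rw [← ψ.coprod_comp_inl_inr, LinearMap.coprod_apply, map_add, map_smul, map_neg]
        exact add_mem (add_mem (hle (K.apply_d_mem _ (ψ ∘ₗ LinearMap.inl R _ _) _))
          (Ideal.mul_mem_right _ _ ha))
          (neg_mem (hle (K.apply_d_mem _ (ψ ∘ₗ LinearMap.inr R _ _) _)))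
      exact key ψ
  exists_top := by
    obtain ⟨n, φ, hφ, e, he⟩ := K.exists_top
    refine ⟨n + 1, φ ∘ₗ LinearMap.snd R (K.X (n + 1)) (K.X n), ?_, ((0 : K.X (n + 1)), e), he⟩
    refine LinearMap.ext fun x => ?_
    obtain ⟨x, y⟩ : K.X (n + 2) × K.X (n + 1) := x
    change φ (-K.d n y) = 0
    simpa using LinearMap.congr_fun hφ y

lemma nonempty_of_finite {S : Set R} (hS : S.Finite) : Nonempty (KoszulLikeComplex R S) := by
  induction S, hS using Set.Finite.induction_on with
  | empty => exact ⟨base R⟩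
  | insert _ _ ih => exact ih.map fun K => K.cone _

lemma smul_mem_range_zero (K : KoszulLikeComplex R S) {a : R} (ha : a ∈ Ideal.span S)
    (x : K.X 0) : a • x ∈ LinearMap.range (K.d 0) := by
  suffices Ideal.span S ≤ (LinearMap.range (K.d 0)).comap (LinearMap.toSpanSingleton R _ x) from
    this ha
  refine Ideal.span_le.2 fun b hb => ?_
  obtain ⟨h, h0, -⟩ := K.exists_homotopy b hb
  exact ⟨h 0 x, h0 x⟩

lemma smul_mem_range_succ (K : KoszulLikeComplex R S) {a : R} (ha : a ∈ Ideal.span S) (i : ℕ)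
    (x : K.X (i + 1)) (hx : K.d i x = 0) : a • x ∈ LinearMap.range (K.d (i + 1)) := by
  suffices Ideal.span S ≤
      (LinearMap.range (K.d (i + 1))).comap (LinearMap.toSpanSingleton R _ x) from this ha
  refine Ideal.span_le.2 fun b hb => ?_
  obtain ⟨h, -, h1⟩ := K.exists_homotopy b hb
  exact ⟨h (i + 1) x, by simpa [hx] using h1 i x⟩

/-- The differential as a map to the cycles. -/
def toCycles (K : KoszulLikeComplex R S) (i : ℕ) :
    K.X (i + 2) →ₗ[R] LinearMap.ker (K.d i) :=
  (K.d (i + 1)).codRestrict _ fun x => LinearMap.mem_ker.2 (K.d_d i x)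

lemma smul_mem_range_toCycles (K : KoszulLikeComplex R S) {a : R} (ha : a ∈ Ideal.span S) (i : ℕ)
    (z : LinearMap.ker (K.d i)) : a • z ∈ LinearMap.range (K.toCycles i) := by
  obtain ⟨y, hy⟩ := K.smul_mem_range_succ ha i z z.2
  exact ⟨y, Subtype.ext hy⟩

/-- Dimension shifting along boundaries in cycles, and cycles in projective terms. The quotients of
cycles by boundaries are killed by `J`, so strength applies in degree `j + 2 ≥ 2`. -/
lemma subsingleton_ext_range (K : KoszulLikeComplex R S) (hJ : IsGVIdeal R (Ideal.span S))
    (hR : IsStrongWModule R R) (i j : ℕ) :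
    Subsingleton (Ext (ModuleCat.of R (LinearMap.range (K.d i))) (ModuleCat.of R R) (j + 1)) := by
  have hproj (i j : ℕ) : Subsingleton (Ext (ModuleCat.of R (K.X i)) (ModuleCat.of R R) (j + 1)) := by
    have : Projective (ModuleCat.of R (K.X i)) :=
      (IsProjective.iff_projective _).1 (K.projective i)
    exact Ext.subsingleton_of_projective _ _ j
  induction i generalizing j with
  | zero =>
    refine subsingleton_ext_of_shortExact (LinearMap.range (K.d 0)).subtype
      (LinearMap.range (K.d 0)).mkQ (Submodule.subtype_injective _) (Submodule.mkQ_surjective _)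
      (LinearMap.exact_subtype_mkQ _) (j + 1) (hproj 0 j) (hR.2 _ (hJ.isGVTorsion ?_) _ (by omega))
    intro a ha x
    obtain ⟨x, rfl⟩ := Submodule.mkQ_surjective _ x
    rw [← map_smul]
    exact (Submodule.Quotient.mk_eq_zero _).2 (K.smul_mem_range_zero ha x)
  | succ i ih =>
    have hZ : Subsingleton
        (Ext (ModuleCat.of R (LinearMap.ker (K.d i))) (ModuleCat.of R R) (j + 1)) := by
      refine subsingleton_ext_of_shortExact (LinearMap.ker (K.d i)).subtype
        (K.d i).rangeRestrict (Submodule.subtype_injective _) (K.d i).surjective_rangeRestrict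
        -- The shift raises the degree by one, so the induction must hold for all `j`.
        ?_ (j + 1) (hproj (i + 1) j) (ih (j + 1))
      intro x
      simp [Subtype.ext_iff]
    have hle : LinearMap.range (K.d (i + 1)) ≤ LinearMap.ker (K.d i) := by
      rintro _ ⟨x, rfl⟩
      exact K.d_d i x
    refine subsingleton_ext_of_shortExact (Submodule.inclusion hle)
      (LinearMap.range (Submodule.inclusion hle)).mkQ (Submodule.inclusion_injective _)
      (Submodule.mkQ_surjective _) (LinearMap.exact_map_mkQ_range _) (j + 1) hZ
      (hR.2 _ (hJ.isGVTorsion ?_) _ (by omega))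
    intro a ha x
    obtain ⟨x, rfl⟩ := Submodule.mkQ_surjective _ x
    rw [← map_smul]
    refine (Submodule.Quotient.mk_eq_zero _).2 ?_
    exact ⟨⟨a • (x : K.X (i + 1)), K.smul_mem_range_succ ha i x x.2⟩, rfl⟩

/-- The dual complex is exact in degree zero. -/
lemma eq_zero_of_comp_d_eq_zero (K : KoszulLikeComplex R S) (hJ : IsGVIdeal R (Ideal.span S))
    (φ : K.X 0 →ₗ[R] R) (hφ : φ ∘ₗ K.d 0 = 0) : φ = 0 := by
  refine LinearMap.ext fun x => hJ.eq_zero_of_forall_mul_eq_zero fun a ha => ?_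
  obtain ⟨y, hy⟩ := K.smul_mem_range_zero ha x
  rw [← smul_eq_mul, ← map_smul, ← hy]
  exact LinearMap.congr_fun hφ y

/-- The dual complex is exact in positive degrees. -/
lemma exists_comp_d_eq (K : KoszulLikeComplex R S) (hJ : IsGVIdeal R (Ideal.span S))
    (hR : IsStrongWModule R R) (i : ℕ) (φ : K.X (i + 1) →ₗ[R] R)
    (hφ : φ ∘ₗ K.d (i + 1) = 0) : ∃ ψ : K.X i →ₗ[R] R, ψ ∘ₗ K.d i = φ := by
  -- `J` carries cycles into boundaries, which `φ` kills, and `R` has no `J`-torsion.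
  have hker : LinearMap.ker (K.d i) ≤ LinearMap.ker φ := by
    refine fun x hx => hJ.eq_zero_of_forall_mul_eq_zero fun a ha => ?_
    obtain ⟨y, hy⟩ := K.smul_mem_range_succ ha i x hx
    rw [← smul_eq_mul, ← map_smul, ← hy]
    exact LinearMap.congr_fun hφ y
  cases i with
  | zero => exact hJ.exists_comp_eq _ (fun a ha x => K.smul_mem_range_zero ha x) φ hker
  | succ i =>
    -- First `φ` factors through the cycles; the factor then extends to the whole term because
    -- `Ext¹` of the next boundaries vanishes.
    obtain ⟨g, rfl⟩ := hJ.exists_comp_eq (K.toCycles i)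
      (fun a ha z => K.smul_mem_range_toCycles ha i z) φ
      (by rwa [toCycles, LinearMap.ker_codRestrict])
    obtain ⟨ψ, rfl⟩ := exists_extend_of_subsingleton_ext (LinearMap.ker (K.d i)).subtype
      (K.d i).rangeRestrict (Submodule.subtype_injective _) (K.d i).surjective_rangeRestrict
      (fun x => by simp [Subtype.ext_iff]) (K.subsingleton_ext_range hJ hR i 0) g
    exact ⟨ψ, rfl⟩

lemma span_eq_top (K : KoszulLikeComplex R S) (hJ : IsGVIdeal R (Ideal.span S))
    (hR : IsStrongWModule R R) : Ideal.span S = ⊤ := by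
  rw [Ideal.eq_top_iff_one]
  obtain ⟨n, φ, hφ, e, he⟩ := K.exists_top
  rw [← he]
  cases n with
  -- Here `φ = 0`, so `1 = φ e = 0`.
  | zero => simp [K.eq_zero_of_comp_d_eq_zero hJ φ hφ]
  | succ n =>
    obtain ⟨ψ, rfl⟩ := K.exists_comp_d_eq hJ hR n φ hφ
    exact K.apply_d_mem n ψ e

end KoszulLikeComplex

end Koszul

/-! ### The converse and the equivalence -/

lemma subsingleton_ext_of_subsingleton {R : Type u} [CommRing R] (T M : Type u) [AddCommGroup T]
    [Module R T] [AddCommGroup M] [Module R M] [Subsingleton T] (n : ℕ) :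
    Subsingleton (Ext (ModuleCat.of R T) (ModuleCat.of R M) n) := by
  refine subsingleton_of_forall_eq 0 fun x => ?_
  have h : 𝟙 (ModuleCat.of R T) = 0 :=
    (ModuleCat.isZero_of_subsingleton (ModuleCat.of R T)).eq_of_src _ _
  rw [← Ext.mk₀_id_comp x, h, Ext.mk₀_zero, Ext.zero_comp]

lemma isGVIdeal_top (R : Type u) [CommRing R] : IsGVIdeal R ⊤ := by
  have : Subsingleton (R ⧸ (⊤ : Ideal R)) := Ideal.Quotient.subsingleton_iff.2 rfl
  exact ⟨⟨{1}, by simp⟩, inferInstance, subsingleton_ext_of_subsingleton _ _ 1⟩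

lemma IsDWRing.isStrongWModule {R : Type u} [CommRing R] (h : IsDWRing R) (M : Type u)
    [AddCommGroup M] [Module R M] : IsStrongWModule R M := by
  have htor (T : Type u) [AddCommGroup T] [Module R T] : torGV R T = {0} := by
    ext x
    simp only [torGV, show GV R = {⊤} from h, Set.mem_singleton_iff, exists_eq_left, Set.mem_ofPred_eq]
    exact ⟨fun hx => by simpa using hx 1 trivial, fun hx a _ => by simp [hx]⟩
  refine ⟨⟨htor M, fun J hJ => ?_⟩, fun T _ _ hT i _ => ?_⟩
  · rw [show GV R = {⊤} from h, Set.mem_singleton_iff] at hJ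
    subst hJ
    have : Subsingleton (R ⧸ (⊤ : Ideal R)) := Ideal.Quotient.subsingleton_iff.2 rfl
    exact subsingleton_ext_of_subsingleton _ _ 1
  · have : Subsingleton T := by
      refine subsingleton_of_forall_eq 0 fun x => ?_
      have hx : x ∈ torGV R T := hT ▸ Set.mem_univ x
      rwa [htor T] at hx
    exact subsingleton_ext_of_subsingleton _ _ i

theorem mainTheorem6 (R : Type u) [CommRing R] : IsStrongWModule R R ↔ IsDWRing R := by
  refine ⟨fun hR => Set.eq_singleton_iff_unique_mem.2 ⟨isGVIdeal_top R, fun J hJ => ?_⟩,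
    fun h => h.isStrongWModule R⟩
  obtain ⟨S, rfl⟩ := (hJ : IsGVIdeal R J).1
  obtain ⟨K⟩ := KoszulLikeComplex.nonempty_of_finite (R := R) S.finite_toSet
  exact K.span_eq_top hJ hR
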